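/- Let $0<\alpha\le 2$, $\sigma>0$, $-1\le\beta\le 1$, $\delta\in\mathbb R$, and let $\mu$ be the stable law on $\mathbb R$ whose characteristic function $\phi$ is $$\phi(s)=\begin{cases}\exp\bigl\{-\sigma^\alpha|s|^\alpha\bigl(1-i\beta\,\mathrm{sign}(s)\tan\tfrac{\pi\alpha}{2}\bigr)+i\delta s\bigr\}&\alpha\ne 1,\\ \exp\bigl\{-\sigma|s|\bigl(1+i\beta\tfrac{2}{\pi}\mathrm{sign}(s)\ln|s|\bigr)+i\delta s\bigr\}&\alpha=1.\end{cases}$$ Fix $t\neq 0$. For $i=1,2$ let $X^{(i)}_1,X^{(i)}_2,\dots$ be i.i.d. random variables with law $\mu$, and put $$Z^{(i)}_n=\frac1n\sum_{k=1}^n\begin{bmatrix}\cos(tX^{(i)}_k)\\ \sin(tX^{(i)}_k)\end{bmatrix},\qquad Z_0=\begin{bmatrix}\mathrm{Re}\,\phi(t)\\ \mathrm{Im}\,\phi(t)\end{bmatrix}.$$ Let $\Sigma_z=\begin{bmatrix}\sigma_{11}&\sigma_{12}\\ \sigma_{12}&\sigma_{22}\end{bmatrix}$ be the matrix with the (real)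 entries $$\sigma_{11}=\tfrac14\bigl[\phi(2t)+2+\phi(-2t)-\phi(t)^2-2\phi(t)\phi(-t)-\phi(-t)^2\bigr],$$ $$\sigma_{22}=\tfrac14\bigl[\phi(t)^2-2\phi(t)\phi(-t)+\phi(-t)^2\bigr]-\tfrac14\bigl[\phi(2t)+\phi(-2t)-2\bigr],$$ $$\sigma_{12}=\tfrac1{4i}\bigl[\phi(2t)-\phi(t)^2-\phi(-2t)+\phi(-t)^2\bigr],$$ and let $\hat\Sigma_z=\hat\Sigma_{z,n}$ be random real $2\times2$ matrices, defined on the same probability space as the samples, with $\hat\Sigma_{z,n}\xrightarrow{d}\Sigma_z$ as $n\to\infty$. Then, as $n\to\infty$: (a) for $i=1,2$, $\ n\,[Z^{(i)}_n-Z_0]'\,\hat\Sigma_z^{-1}\,[Z^{(i)}_n-Z_0]\xrightarrow{d}\chi^2(2)$; (b) if moreover the two samples are independent of each other, then $\hat T_{1,2}:=n\,[Z^{(1)}_n-Z^{(2)}_n]'\,\hat\Sigma_z^{-1}\,[Z^{(1)}_n-Z^{(2)}_n]$ converges in distribution to $2Y$, where $Y\sim\chi^2(2)$; equivalently, $\tfrac12\hat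 T_{1,2}\xrightarrow{d}\chi^2(2)$. (Where $\hat\Sigma_z$ is singular, which happens with probability tending to $0$, $\hat\Sigma_z^{-1}$ is read as the zero matrix.) -/

import Mathlib

open MeasureTheory ProbabilityTheory Filter
open scoped Matrix

noncomputable section

/-- The stable characteristic function with index of stability `α`, scale `σ`, skewness `β`,
location `δ`. -/
def stableCharFun (α σ β δ t : ℝ) : ℂ :=
  if α ≠ 1 then
    Complex.exp (-((σ ^ α * |t| ^ α : ℝ) : ℂ) *
        (1 - Complex.I * ((β * Real.sign t * Real.tan (Real.pi * α / 2) : ℝ) : ℂ))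
      + Complex.I * ((δ * t : ℝ) : ℂ))
  else
    Complex.exp (-((σ * |t| : ℝ) : ℂ) *
        (1 + Complex.I * ((β * (2 / Real.pi) * Real.sign t * Real.log |t| : ℝ) : ℂ))
      + Complex.I * ((δ * t : ℝ) : ℂ))

/-- `μ` is the stable law on `ℝ` with parameters `0 < α ≤ 2`, `0 ≤ σ`, `-1 ≤ β ≤ 1`, `δ ∈ ℝ`. -/
structure IsStableLaw (α σ β δ : ℝ) (μ : Measure ℝ) : Prop where
  isProbabilityMeasure : IsProbabilityMeasure μ
  alpha_pos : 0 < α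
  alpha_le_two : α ≤ 2
  sigma_nonneg : 0 ≤ σ
  neg_one_le_beta : -1 ≤ β
  beta_le_one : β ≤ 1
  charFun_eq : ∀ t : ℝ, charFun μ t = stableCharFun α σ β δ t

/-- The empirical characteristic function vector
`Z_n(t) = (1/n) ∑_{k<n} (cos (t x_k), sin (t x_k))` of the first `n` terms of `x`. -/
def ecfVec (t : ℝ) (x : ℕ → ℝ) (n : ℕ) : Fin 2 → ℝ :=
  (1 / (n : ℝ)) • ∑ k ∈ Finset.range n, ![Real.cos (t * x k), Real.sin (t * x k)]

/-- The vector `Z_0(t) = (Re φ(t), Im φ(t))`, where `φ` is the characteristic function of `μ`. -/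
def cfVec (μ : Measure ℝ) (t : ℝ) : Fin 2 → ℝ :=
  ![(charFun μ t).re, (charFun μ t).im]

/-- The entry `σ₁₁` of `Σ_z`, as a complex number. -/
def sigma11 (φ : ℝ → ℂ) (t : ℝ) : ℂ :=
  (1 / 4) * (φ (2 * t) + 2 + φ (-(2 * t)) - φ t ^ 2 - 2 * φ t * φ (-t) - φ (-t) ^ 2)

/-- The entry `σ₂₂` of `Σ_z`, as a complex number. -/
def sigma22 (φ : ℝ → ℂ) (t : ℝ) : ℂ :=
  (1 / 4) * (φ t ^ 2 - 2 * φ t * φ (-t) + φ (-t) ^ 2)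
    - (1 / 4) * (φ (2 * t) + φ (-(2 * t)) - 2)

/-- The entry `σ₁₂ = σ₂₁` of `Σ_z`, as a complex number. -/
def sigma12 (φ : ℝ → ℂ) (t : ℝ) : ℂ :=
  (1 / (4 * Complex.I)) * (φ (2 * t) - φ t ^ 2 - φ (-(2 * t)) + φ (-t) ^ 2)

/-- The matrix `Σ_z` at `t`. For a characteristic function the three complex expressions are real
(see `sigma_im_eq_zero`), so taking real parts loses nothing. -/
def sigmaZ (μ : Measure ℝ) (t : ℝ) : Matrix (Fin 2) (Fin 2) ℝ :=
  !![(sigma11 (charFun μ) t).re, (sigma12 (charFun μ) t).re;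
     (sigma12 (charFun μ) t).re, (sigma22 (charFun μ) t).re]

theorem sigma_im_eq_zero (μ : Measure ℝ) (t : ℝ) :
    (sigma11 (charFun μ) t).im = 0 ∧ (sigma12 (charFun μ) t).im = 0 ∧
      (sigma22 (charFun μ) t).im = 0 := by
  have h1 : (4 * Complex.I)⁻¹ = -Complex.I / 4 := by
    rw [mul_inv, Complex.inv_I]; ring
  refine ⟨?_, ?_, ?_⟩ <;>
    simp [sigma11, sigma12, sigma22, h1, charFun_neg, pow_two] <;> ring

/-- The statistic `n (z - w)' S⁻¹ (z - w)`. -/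
def mahalanobisStat (n : ℕ) (S : Matrix (Fin 2) (Fin 2) ℝ) (z w : Fin 2 → ℝ) : ℝ :=
  (n : ℝ) * ((z - w) ⬝ᵥ (S⁻¹ *ᵥ (z - w)))

/-- The `χ²(k)` law: the law of the sum of squares of `k` independent standard normals. -/
def chiSquared (k : ℕ) : Measure ℝ :=
  (Measure.pi fun _ : Fin k => gaussianReal 0 1).map fun x => ∑ i, x i ^ 2

instance (k : ℕ) : IsProbabilityMeasure (chiSquared k) :=
  Measure.isProbabilityMeasure_map
    (Finset.univ.measurable_sum fun i _ => (measurable_pi_apply i).pow_const 2).aemeasurable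

/-- Real matrices carry the product (equivalently Borel) σ-algebra of arrays of real numbers. -/
instance : MeasurableSpace (Matrix (Fin 2) (Fin 2) ℝ) :=
  inferInstanceAs (MeasurableSpace (Fin 2 → Fin 2 → ℝ))

instance : BorelSpace (Matrix (Fin 2) (Fin 2) ℝ) :=
  inferInstanceAs (BorelSpace (Fin 2 → Fin 2 → ℝ))

end

open scoped RealInnerProductSpace Topology

/-! The vector `√n (Z_n - Z_0)` is a normalised sum of i.i.d. bounded vectors with covariance `Σ_z`,
so it tends to `N(0, Σ_z)`. Slutsky's lemma replaces the estimated inverse by `Σ_z⁻¹`, and whitening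
turns the limiting form into a sum of two squared standard normals. For two independent samples, the
difference of deviations divided by `√2` has the same Gaussian limit, which accounts for the factor
2.

The substantial point is that `Σ_z` is invertible (`posDef_sigmaZ`). Otherwise some nontrivial `a
cos(tx) + b sin(tx)` is a.s. a constant `c`. Multiplying by `exp(intx)` and integrating gives a
two-term recurrence for `φ(nt)` whose roots have product of modulus one. Since `φ(nt) → 0`, the
solution is geometric, and its values `φ(-t), 1, φ(t)` force `|φ(t)| = 1`. This contradicts `|φ(t)|
= exp(-(σ|t|)^α) < 1`. -/

/-- Changing the limiting random variable to one with the same law. -/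
theorem tendstoInDistribution_of_map_limit_eq {ι E Ω₁ Ω₂ : Type*} {Ω : ι → Type*}
    [∀ i, MeasurableSpace (Ω i)] [MeasurableSpace Ω₁] [MeasurableSpace Ω₂]
    {P : ∀ i, Measure (Ω i)} [∀ i, IsProbabilityMeasure (P i)]
    {P₁ : Measure Ω₁} [IsProbabilityMeasure P₁] {P₂ : Measure Ω₂} [IsProbabilityMeasure P₂]
    [TopologicalSpace E] [MeasurableSpace E] [OpensMeasurableSpace E]
    {X : ∀ i, Ω i → E} {l : Filter ι} {Z₁ : Ω₁ → E} {Z₂ : Ω₂ → E}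
    (h : TendstoInDistribution X l Z₁ P P₁) (hZ : AEMeasurable Z₂ P₂)
    (heq : P₁.map Z₁ = P₂.map Z₂) :
    TendstoInDistribution X l Z₂ P P₂ where
  forall_aemeasurable := h.forall_aemeasurable
  aemeasurable_limit := hZ
  tendsto := by
    have := h.tendsto
    simp only [heq] at this
    exact this

/-- Convergence in distribution to a constant passes to convergence in probability through a map
continuous at that constant. -/
theorem tendstoInMeasure_comp_of_tendstoInDistribution_const {ι E F Ω Ω' : Type*}
    [MeasurableSpace Ω] [MeasurableSpace Ω'] {P : Measure Ω} [IsProbabilityMeasure P]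
    {P' : Measure Ω'} [IsProbabilityMeasure P']
    [TopologicalSpace E] [MeasurableSpace E] [OpensMeasurableSpace E] [HasOuterApproxClosed E]
    [PseudoMetricSpace F] {l : Filter ι} {S : ι → Ω → E} {c : E} {f : E → F}
    (h : TendstoInDistribution S l (fun _ : Ω' => c) (fun _ => P) P') (hf : ContinuousAt f c) :
    TendstoInMeasure P (fun n ω => f (S n ω)) l (fun _ => f c) := by
  rw [tendstoInMeasure_iff_dist]
  intro ε hε
  obtain ⟨U, hUsub, hUo, hcU⟩ := mem_nhds_iff.1 (hf (Metric.ball_mem_nhds (f c) hε))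
  -- Portmanteau on a closed set to which the limiting point mass gives no mass.
  have hlim := ProbabilityMeasure.limsup_measure_closed_le_of_tendsto h.tendsto
    hUo.isClosed_compl
  have hzero : (P'.map (fun _ : Ω' => c)) Uᶜ = 0 := by
    rw [Measure.map_const]
    simp [hUo.measurableSet.compl, hcU]
  simp only [ProbabilityMeasure.coe_mk, hzero, nonpos_iff_eq_zero] at hlim
  have htend : Tendsto (fun n => (P.map (S n)) Uᶜ) l (𝓝 0) :=
    tendsto_of_le_liminf_of_limsup_le zero_le hlim.le
  refine tendsto_of_tendsto_of_tendsto_of_le_of_le tendsto_const_nhds htend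
    (fun _ => zero_le) fun n => ?_
  rw [Measure.map_apply_of_aemeasurable (h.forall_aemeasurable n) hUo.measurableSet.compl]
  refine measure_mono fun ω hω hmem => ?_
  exact absurd (show dist (f (S n ω)) (f c) < ε from hUsub hmem) (not_lt.2 hω)

/-! ### Gaussian limits of random vectors -/

section Gaussian

variable {Ω ι : Type*} [MeasurableSpace Ω] {P : Measure Ω} [Fintype ι]

/-- The Cramér–Wold device: it reduces the vector limit theorem to the scalar one. -/
theorem charFun_map_eq_charFun_map_inner {Y : Ω → EuclideanSpace ℝ ι} (hY : AEMeasurable Y P)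
    (ξ : EuclideanSpace ℝ ι) :
    charFun (P.map Y) ξ = charFun (P.map fun ω => ⟪ξ, Y ω⟫) 1 := by
  rw [charFun_apply, charFun_apply, integral_map hY (by fun_prop),
    integral_map (by fun_prop) (by fun_prop)]
  simp [real_inner_comm]

variable [IsProbabilityMeasure P] [DecidableEq ι]

/-- The central limit theorem for random vectors. -/
theorem tendstoInDistribution_multivariateGaussian {Y : ℕ → Ω → EuclideanSpace ℝ ι}
    {C : Matrix ι ι ℝ} (hC : C.PosSemidef) (hY : MemLp (Y 0) 2 P) (hindep : iIndepFun Y P)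
    (hident : ∀ k, IdentDistrib (Y k) (Y 0) P P)
    (hcov : ∀ ξ : EuclideanSpace ℝ ι, Var[fun ω => ⟪ξ, Y 0 ω⟫; P] = ξ ⬝ᵥ C *ᵥ ξ) :
    TendstoInDistribution
      (fun (n : ℕ) ω => (√(n : ℝ))⁻¹ • (∑ k ∈ Finset.range n, Y k ω - (n : ℝ) • P[Y 0])) atTop
      (fun x => x) (fun _ => P) (multivariateGaussian 0 C) := by
  have hm (k : ℕ) : AEMeasurable (Y k) P := (hident k).aemeasurable_fst
  have hsum (n : ℕ) : AEMeasurable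
      (fun ω => (√(n : ℝ))⁻¹ • (∑ k ∈ Finset.range n, Y k ω - (n : ℝ) • P[Y 0])) P :=
    ((Finset.aemeasurable_fun_sum _ fun k _ => hm k).sub_const _).fun_const_smul _
  refine ⟨hsum, by fun_prop, ProbabilityMeasure.tendsto_iff_tendsto_charFun.2 fun ξ => ?_⟩
  have hclt := tendstoInDistribution_inv_sqrt_mul_sum_sub (P := P)
    (X := fun k ω => ⟪ξ, Y k ω⟫) (Y := id)
    (P' := gaussianReal 0 Var[fun ω => ⟪ξ, Y 0 ω⟫; P].toNNReal) HasLaw.id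
    (hY.const_inner ξ) (hindep.comp (fun _ y => ⟪ξ, y⟫) (by fun_prop))
    (fun k => (hident k).comp (u := fun y => ⟪ξ, y⟫) (by fun_prop))
  have hchar := ProbabilityMeasure.tendsto_iff_tendsto_charFun.1 hclt.tendsto 1
  simp only [ProbabilityMeasure.coe_mk] at hchar ⊢
  have hlhs (n : ℕ) : charFun (P.map fun ω =>
      (√(n : ℝ))⁻¹ • (∑ k ∈ Finset.range n, Y k ω - (n : ℝ) • P[Y 0])) ξ =
      charFun (P.map fun ω =>
        (√(n : ℝ))⁻¹ * (∑ k ∈ Finset.range n, ⟪ξ, Y k ω⟫ - n * P[fun ω => ⟪ξ, Y 0 ω⟫])) 1 := by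
    rw [charFun_map_eq_charFun_map_inner (hsum n)]
    simp only [inner_smul_right, inner_sub_right, inner_sum,
      integral_inner (hY.integrable one_le_two)]
  simp only [hlhs]
  convert hchar using 2
  rw [Measure.map_id', Measure.map_id, charFun_multivariateGaussian hC, charFun_gaussianReal,
    ← hcov, Real.coe_toNNReal _ (variance_nonneg _ _)]
  simp

/-- If two independent sequences converge to the same centred Gaussian vector, so does their
difference divided by `√2`. -/
theorem tendstoInDistribution_sub_multivariateGaussian {U V : ℕ → Ω → EuclideanSpace ℝ ι}
    {C : Matrix ι ι ℝ} (hC : C.PosSemidef)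
    (hU : TendstoInDistribution U atTop (fun x => x) (fun _ => P) (multivariateGaussian 0 C))
    (hV : TendstoInDistribution V atTop (fun x => x) (fun _ => P) (multivariateGaussian 0 C))
    (hUV : ∀ n, IndepFun (U n) (V n) P) :
    TendstoInDistribution (fun n ω => (√2 : ℝ)⁻¹ • (U n ω - V n ω)) atTop (fun x => x)
      (fun _ => P) (multivariateGaussian 0 C) := by
  have hmU := hU.forall_aemeasurable
  have hmV := hV.forall_aemeasurable
  refine ⟨fun n => ((hmU n).sub (hmV n)).fun_const_smul _, by fun_prop,
    ProbabilityMeasure.tendsto_iff_tendsto_charFun.2 fun ξ => ?_⟩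
  have hchar (n : ℕ) : charFun (P.map fun ω => (√2 : ℝ)⁻¹ • (U n ω - V n ω)) ξ =
      charFun (P.map (U n)) ((√2 : ℝ)⁻¹ • ξ) * charFun (P.map (V n)) (-((√2 : ℝ)⁻¹ • ξ)) := by
    have hsplit : (fun ω => (√2 : ℝ)⁻¹ • (U n ω - V n ω)) =
        fun ω => (√2 : ℝ)⁻¹ • U n ω + (-(√2 : ℝ)⁻¹) • V n ω := by
      ext1 ω; module
    rw [hsplit, IndepFun.charFun_map_fun_add_eq_mul ((hmU n).fun_const_smul _)
      ((hmV n).fun_const_smul _) ((hUV n).comp (φ := fun x => (√2 : ℝ)⁻¹ • x)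
        (ψ := fun x => (-(√2 : ℝ)⁻¹) • x) (by fun_prop) (by fun_prop)), Pi.mul_apply,
      charFun_map_smul_comp (hmU n), charFun_map_smul_comp (hmV n), neg_smul]
  have hlimU := ProbabilityMeasure.tendsto_iff_tendsto_charFun.1 hU.tendsto ((√2 : ℝ)⁻¹ • ξ)
  have hlimV := ProbabilityMeasure.tendsto_iff_tendsto_charFun.1 hV.tendsto (-((√2 : ℝ)⁻¹ • ξ))
  simp only [ProbabilityMeasure.coe_mk, Measure.map_id', hchar] at hlimU hlimV ⊢
  convert hlimU.mul hlimV using 2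
  simp only [charFun_multivariateGaussian hC, ← Complex.exp_add]
  congr 1
  -- Each of the two factors contributes half of the Gaussian exponent.
  have hsq : (√2 : ℝ)⁻¹ * (√2 : ℝ)⁻¹ = 1 / 2 := by
    rw [← mul_inv, Real.mul_self_sqrt zero_le_two, one_div]
  simp only [inner_zero_right, WithLp.ofLp_neg, WithLp.ofLp_smul, Matrix.mulVec_neg,
    Matrix.mulVec_smul, neg_dotProduct, dotProduct_neg, smul_dotProduct, dotProduct_smul,
    smul_eq_mul]
  have hsq' := congrArg (fun r : ℝ => (r : ℂ)) hsq
  push_cast at hsq' ⊢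
  linear_combination ((ξ.ofLp ⬝ᵥ C *ᵥ ξ.ofLp : ℝ) : ℂ) * hsq'

/-- Whitening: the Gaussian vector is `R y` with `R = √C` and `y` standard, and `R C⁻¹ R = 1`. -/
theorem map_dotProduct_inv_mulVec_multivariateGaussian {C : Matrix ι ι ℝ} (hC : C.PosDef) :
    (multivariateGaussian 0 C).map (fun x => x.ofLp ⬝ᵥ C⁻¹ *ᵥ x.ofLp) =
      (Measure.pi fun _ : ι => gaussianReal 0 1).map fun x => ∑ i, x i ^ 2 := by
  open scoped MatrixOrder in
  set R := CFC.sqrt C with hR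
  have hRR : R * R = C := CFC.sqrt_mul_sqrt_self _ hC.posSemidef.nonneg
  have hRT : Rᵀ = R := by
    rw [← Matrix.conjTranspose_eq_transpose_of_trivial]
    exact (CFC.sqrt_nonneg C).isSelfAdjoint
  have hdet : IsUnit R.det := by
    have : IsUnit (R.det * R.det) := by
      rw [← Matrix.det_mul, hRR]; exact hC.det_pos.ne'.isUnit
    exact isUnit_of_mul_isUnit_left this
  rw [multivariateGaussian, ← map_pi_eq_stdGaussian,
    Measure.map_map (by fun_prop) (by fun_prop), Measure.map_map (by fun_prop) (by fun_prop)]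
  congr 1
  ext1 x
  have hmul : R * (C⁻¹ * R) = 1 := by
    rw [← hRR, Matrix.mul_inv_rev, Matrix.mul_assoc, Matrix.nonsing_inv_mul _ hdet,
      Matrix.mul_one, Matrix.mul_nonsing_inv _ hdet]
  simp only [Function.comp_apply, zero_add, Matrix.ofLp_toEuclideanCLM, ← hR]
  calc (R *ᵥ x) ⬝ᵥ C⁻¹ *ᵥ R *ᵥ x = x ⬝ᵥ (R * (C⁻¹ * R)) *ᵥ x := by
        rw [← Matrix.mulVec_mulVec, ← Matrix.mulVec_mulVec, Matrix.dotProduct_mulVec x R,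
          ← Matrix.mulVec_transpose, hRT]
    _ = ∑ i, x i ^ 2 := by simp [hmul, dotProduct, sq]

end Gaussian

/-! ### Studentised quadratic forms -/

/-- The estimator may be singular, where inversion can be discontinuous; the adjugate formula with
`0⁻¹ = 0` still gives measurability everywhere. -/
theorem measurable_matrix_inv :
    Measurable (fun M : Matrix (Fin 2) (Fin 2) ℝ => M⁻¹) := by
  have hdet : Measurable fun M : Matrix (Fin 2) (Fin 2) ℝ => M.det⁻¹ :=
    (Continuous.matrix_det continuous_id).measurable.inv
  have hadj : Continuous fun M : Matrix (Fin 2) (Fin 2) ℝ => M.adjugate :=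
    Continuous.matrix_adjugate continuous_id
  simp only [Matrix.inv_def, Ring.inverse_eq_inv']
  refine measurable_pi_lambda _ fun i => measurable_pi_lambda _ fun j => ?_
  exact hdet.mul ((continuous_apply_apply i j).comp hadj).measurable

/-- Studentised quadratic forms of asymptotically Gaussian plane vectors are asymptotically
`χ²(2)`. -/
theorem tendstoInDistribution_quadraticForm_chiSquared {Ω Ω' : Type*} [MeasurableSpace Ω]
    [MeasurableSpace Ω'] {P : Measure Ω} [IsProbabilityMeasure P]
    {P' : Measure Ω'} [IsProbabilityMeasure P']
    {C : Matrix (Fin 2) (Fin 2) ℝ} (hC : C.PosDef)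
    {T : ℕ → Ω → EuclideanSpace ℝ (Fin 2)} {S : ℕ → Ω → Matrix (Fin 2) (Fin 2) ℝ}
    (hT : TendstoInDistribution T atTop (fun x => x) (fun _ => P) (multivariateGaussian 0 C))
    (hS : TendstoInDistribution S atTop (fun _ : Ω' => C) (fun _ => P) P') :
    TendstoInDistribution (fun n ω => (T n ω).ofLp ⬝ᵥ (S n ω)⁻¹ *ᵥ (T n ω).ofLp) atTop
      (fun y => y) (fun _ => P) (chiSquared 2) := by
  have hS' : TendstoInDistribution (E := Fin 2 → Fin 2 → ℝ) S atTop (fun _ : Ω' => C)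
    (fun _ => P) P' := hS
  -- Convergence in probability needs a distance, so inversion is read as a map of arrays.
  set f : (Fin 2 → Fin 2 → ℝ) → Fin 2 → Fin 2 → ℝ := fun M i j => (Matrix.of M)⁻¹ i j with hf
  have hcontAt : ContinuousAt f C := continuousAt_matrix_inv C <| by
    rw [Ring.inverse_eq_inv']
    exact continuousAt_inv₀ hC.det_pos.ne'
  have hinv : TendstoInMeasure P (fun n ω => f (S n ω)) atTop (fun _ => f C) :=
    tendstoInMeasure_comp_of_tendstoInDistribution_const (E := Fin 2 → Fin 2 → ℝ) hS' hcontAt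
  have hmeas (n : ℕ) : AEMeasurable (fun ω => f (S n ω)) P :=
    measurable_matrix_inv.comp_aemeasurable (hS.forall_aemeasurable n)
  have hcont : Continuous fun p : EuclideanSpace ℝ (Fin 2) × (Fin 2 → Fin 2 → ℝ) =>
      p.1.ofLp ⬝ᵥ (Matrix.of p.2) *ᵥ p.1.ofLp := by
    simp only [dotProduct, Matrix.mulVec, Matrix.of_apply]
    fun_prop
  have hlim := hT.continuous_comp_prodMk_of_tendstoInMeasure_const hcont hinv hmeas
  refine tendstoInDistribution_of_map_limit_eq hlim (by fun_prop) ?_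
  rw [Measure.map_id', chiSquared, ← map_dotProduct_inv_mulVec_multivariateGaussian hC]
  rfl

/-! ### Nondegeneracy of the trigonometric vector -/

/-- A two-term linear recurrence whose characteristic roots multiply to modulus one: a solution
tending to zero is geometric. -/
theorem exists_geometric_of_tendsto_zero {g : ℕ → ℂ} {u v : ℂ} (huv : ‖u * v‖ = 1)
    (hrec : ∀ n, g (n + 2) - (u + v) * g (n + 1) + u * v * g n = 0)
    (hg : Tendsto g atTop (𝓝 0)) : ∃ r, ∀ n, g (n + 1) = r * g n := by
  -- The roots cannot both lie inside the unit disc.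
  wlog hv : 1 ≤ ‖v‖ generalizing u v
  · refine this (u := v) (v := u) (by rwa [mul_comm]) (fun n => ?_) ?_
    · rw [← hrec n]; ring
    · by_contra! hu
      rw [norm_mul] at huv
      nlinarith [norm_nonneg u, norm_nonneg v]
  -- Removing the root `u` leaves a multiple of `v ^ n`, which cannot decay unless it is zero.
  have hpow (n : ℕ) : g (n + 1) - u * g n = v ^ n * (g 1 - u * g 0) := by
    induction n with
    | zero => simp
    | succ n ih => rw [pow_succ', mul_assoc, ← ih]; linear_combination hrec n
  have hlim : Tendsto (fun n => ‖g (n + 1) - u * g n‖) atTop (𝓝 0) := by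
    simpa using ((hg.comp (tendsto_add_atTop_nat 1)).sub (hg.const_mul u)).norm
  have hzero : g 1 - u * g 0 = 0 := by
    refine norm_le_zero_iff.1 <| ge_of_tendsto' hlim fun n => ?_
    rw [hpow n, norm_mul, norm_pow]
    exact le_mul_of_one_le_left (norm_nonneg (g 1 - u * g 0)) (one_le_pow₀ hv)
  exact ⟨u, fun n => sub_eq_zero.1 (by rw [hpow, hzero, mul_zero])⟩

theorem integrable_cexp_mul_I (μ : Measure ℝ) [IsProbabilityMeasure μ] (s : ℝ) :
    Integrable (fun x : ℝ => Complex.exp (s * x * Complex.I)) μ := by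
  refine Integrable.of_bound (C := 1) (by fun_prop) (.of_forall fun x => ?_)
  rw [← Complex.ofReal_mul, Complex.norm_exp_ofReal_mul_I]

/-- If the characteristic function vanishes along the multiples of `t` and has modulus different
from `1` at `t`, then no nontrivial combination of `cos (t x)`, `sin (t x)` is almost surely
constant. -/
theorem not_ae_eq_const_cos_sin {μ : Measure ℝ} [IsProbabilityMeasure μ] {t a b c : ℝ}
    (hlim : Tendsto (fun n : ℕ => charFun μ (n * t)) atTop (𝓝 0)) (hone : ‖charFun μ t‖ ≠ 1)
    (hab : a ≠ 0 ∨ b ≠ 0) :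
    ¬ ∀ᵐ x ∂μ, a * Real.cos (t * x) + b * Real.sin (t * x) = c := by
  intro h
  -- Chosen so that `a cos θ + b sin θ = A exp(iθ) + B exp(-iθ)`.
  set A : ℂ := (a - b * Complex.I) / 2 with hA
  set B : ℂ := (a + b * Complex.I) / 2 with hB
  have hAB : B = (starRingEnd ℂ) A := by
    simp [hA, hB, Complex.conj_ofNat]
  have hA0 : A ≠ 0 := by
    intro h0
    have hre := congrArg Complex.re h0
    have him := congrArg Complex.im h0
    simp [hA] at hre him
    tauto
  -- A square root of the discriminant of `A z² - c z + B`, whose roots are `u` and `v`.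
  obtain ⟨s, hs⟩ := IsAlgClosed.exists_pow_nat_eq ((c : ℂ) ^ 2 - 4 * A * B) (n := 2) two_pos
  set u : ℂ := (c + s) / (2 * A) with hu
  set v : ℂ := (c - s) / (2 * A) with hv
  have hsum : A * (u + v) = c := by rw [hu, hv]; field_simp; ring
  have hprod : A * (u * v) = B := by
    rw [hu, hv]; field_simp; linear_combination -hs
  have huv : ‖u * v‖ = 1 := by
    have := congrArg norm hprod
    rw [norm_mul, hAB, Complex.norm_conj] at this
    exact mul_left_cancel₀ (norm_ne_zero_iff.2 hA0) (by rw [this, mul_one])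
  -- The shift by one makes the sequence start at `φ(-t), 1, φ(t)`.
  set g : ℕ → ℂ := fun n => charFun μ (((n : ℝ) - 1) * t) with hg
  have hrec (n : ℕ) : g (n + 2) - (u + v) * g (n + 1) + u * v * g n = 0 := by
    have hkey : A * g (n + 2) + B * g n = c * g (n + 1) := by
      simp only [hg, charFun_apply_real]
      rw [← integral_const_mul, ← integral_const_mul, ← integral_const_mul,
        ← integral_add ((integrable_cexp_mul_I μ _).const_mul _)
          ((integrable_cexp_mul_I μ _).const_mul _)]
      refine integral_congr_ae ?_
      filter_upwards [h] with x hx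
      have hx' := congrArg (fun r : ℝ => (r : ℂ)) hx
      push_cast at hx'
      set E := Complex.exp (((((n + 1 : ℕ) : ℝ) - 1) * t : ℝ) * x * Complex.I) with hE
      have h2 : Complex.exp (((((n + 2 : ℕ) : ℝ) - 1) * t : ℝ) * x * Complex.I) =
          E * (Complex.cos (t * x) + Complex.sin (t * x) * Complex.I) := by
        rw [← Complex.exp_mul_I, hE, ← Complex.exp_add]; push_cast; ring_nf
      have h0 : Complex.exp (((((n : ℕ) : ℝ) - 1) * t : ℝ) * x * Complex.I) =
          E * (Complex.cos (t * x) - Complex.sin (t * x) * Complex.I) := by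
        have hneg : Complex.cos (t * x) - Complex.sin (t * x) * Complex.I =
            Complex.exp (-(t * x) * Complex.I) := by
          rw [Complex.exp_mul_I, Complex.cos_neg, Complex.sin_neg]; ring
        rw [hneg, hE, ← Complex.exp_add]
        push_cast; ring_nf
      rw [h2, h0, hA, hB]
      linear_combination E * hx' - E * b * Complex.sin (t * x) * Complex.I_sq
    refine mul_left_cancel₀ hA0 ?_
    rw [mul_zero]
    linear_combination hkey - g (n + 1) * hsum + g n * hprod
  have hgl : Tendsto g atTop (𝓝 0) := by
    rw [← tendsto_add_atTop_iff_nat 1]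
    simpa [hg] using hlim
  obtain ⟨r, hr⟩ := exists_geometric_of_tendsto_zero huv hrec hgl
  have hg1 : g 1 = 1 := by simp [hg]
  have hg0 : g 0 = (starRingEnd ℂ) (charFun μ t) := by
    rw [← charFun_neg]; simp [hg]
  have hg2 : g 2 = charFun μ t := by
    simp only [hg]; norm_num
  have e1 := hr 0
  have e2 := hr 1
  norm_num [hg1, hg0, hg2] at e1 e2
  rw [← e2, Complex.mul_conj, ← Complex.ofReal_one, Complex.ofReal_inj,
    Complex.normSq_eq_norm_sq] at e1
  exact hone ((pow_eq_one_iff_of_nonneg (norm_nonneg _) two_ne_zero).1 e1.symm)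

/-! ### Modulus of the stable characteristic function -/

/-- Skewness and location enter the exponent only through its imaginary part. -/
theorem norm_stableCharFun {α σ : ℝ} (hσ : 0 ≤ σ) (β δ t : ℝ) :
    ‖stableCharFun α σ β δ t‖ = Real.exp (-(σ * |t|) ^ α) := by
  rw [stableCharFun]
  split_ifs with h
  · generalize β * Real.sign t * Real.tan (Real.pi * α / 2) = r
    rw [Complex.norm_exp, Real.mul_rpow hσ (abs_nonneg t)]
    simp
  · rw [Complex.norm_exp, not_not.1 h, Real.rpow_one]
    simp

theorem IsStableLaw.norm_charFun {α σ β δ : ℝ} {μ : Measure ℝ} (hμ : IsStableLaw α σ β δ μ)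
    (t : ℝ) : ‖charFun μ t‖ = Real.exp (-(σ * |t|) ^ α) := by
  rw [hμ.charFun_eq, norm_stableCharFun hμ.sigma_nonneg]

theorem IsStableLaw.norm_charFun_ne_one {α σ β δ : ℝ} {μ : Measure ℝ}
    (hμ : IsStableLaw α σ β δ μ) (hσ : 0 < σ) {t : ℝ} (ht : t ≠ 0) : ‖charFun μ t‖ ≠ 1 := by
  rw [hμ.norm_charFun]
  have : 0 < (σ * |t|) ^ α := by positivity
  exact ne_of_lt (by simpa using this)

theorem IsStableLaw.tendsto_charFun_natCast_mul {α σ β δ : ℝ} {μ : Measure ℝ}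
    (hμ : IsStableLaw α σ β δ μ) (hσ : 0 < σ) {t : ℝ} (ht : t ≠ 0) :
    Tendsto (fun n : ℕ => charFun μ (n * t)) atTop (𝓝 0) := by
  rw [tendsto_zero_iff_norm_tendsto_zero]
  simp only [hμ.norm_charFun]
  refine Real.tendsto_exp_neg_atTop_nhds_zero.comp ((tendsto_rpow_atTop hμ.alpha_pos).comp ?_)
  have hpos : 0 < σ * |t| := by positivity
  refine (tendsto_natCast_atTop_atTop.const_mul_atTop hpos).congr fun n => ?_
  rw [abs_mul, Nat.abs_cast]; ring

/-! ### The covariance matrix and its positivity -/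

section Covariance

variable (μ : Measure ℝ) (t : ℝ)

theorem sigmaZ_apply_zero_zero :
    sigmaZ μ t 0 0 = ((charFun μ (2 * t)).re + 1) / 2 - (charFun μ t).re ^ 2 := by
  simp [sigmaZ, sigma11, charFun_neg, pow_two]; ring

theorem sigmaZ_apply_one_one :
    sigmaZ μ t 1 1 = (1 - (charFun μ (2 * t)).re) / 2 - (charFun μ t).im ^ 2 := by
  simp [sigmaZ, sigma22, charFun_neg, pow_two]; ring

theorem sigmaZ_apply_zero_one :
    sigmaZ μ t 0 1 = (charFun μ (2 * t)).im / 2 - (charFun μ t).re * (charFun μ t).im := by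
  have h1 : (4 * Complex.I)⁻¹ = -Complex.I / 4 := by
    rw [mul_inv, Complex.inv_I]; ring
  simp [sigmaZ, sigma12, h1, charFun_neg, pow_two]; ring

theorem sigmaZ_apply_one_zero : sigmaZ μ t 1 0 = sigmaZ μ t 0 1 := rfl

variable [IsProbabilityMeasure μ]

theorem charFun_re_eq_integral_cos (s : ℝ) : (charFun μ s).re = ∫ x, Real.cos (s * x) ∂μ := by
  rw [charFun_apply_real]
  have := integral_re (𝕜 := ℂ) (integrable_cexp_mul_I μ s)
  simp only [RCLike.re_eq_complex_re] at this
  rw [← this]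
  congr with x
  rw [← Complex.ofReal_mul, Complex.exp_ofReal_mul_I_re]

theorem charFun_im_eq_integral_sin (s : ℝ) : (charFun μ s).im = ∫ x, Real.sin (s * x) ∂μ := by
  rw [charFun_apply_real]
  have := integral_im (𝕜 := ℂ) (integrable_cexp_mul_I μ s)
  simp only [RCLike.im_eq_complex_im] at this
  rw [← this]
  congr with x
  rw [← Complex.ofReal_mul, Complex.exp_ofReal_mul_I_im]

theorem integrable_cos_mul (s : ℝ) : Integrable (fun x => Real.cos (s * x)) μ :=
  Integrable.of_bound (C := 1) (by fun_prop) (.of_forall fun x => Real.abs_cos_le_one _)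

theorem integrable_sin_mul (s : ℝ) : Integrable (fun x => Real.sin (s * x)) μ :=
  Integrable.of_bound (C := 1) (by fun_prop) (.of_forall fun x => Real.abs_sin_le_one _)

theorem memLp_two_cos_sin (a b : ℝ) :
    MemLp (fun x => a * Real.cos (t * x) + b * Real.sin (t * x)) 2 μ := by
  refine MemLp.of_bound (C := |a| + |b|) (by fun_prop) (.of_forall fun x => ?_)
  refine (abs_add_le _ _).trans ?_
  rw [abs_mul, abs_mul]
  exact add_le_add (mul_le_of_le_one_right (abs_nonneg _) (Real.abs_cos_le_one _))
    (mul_le_of_le_one_right (abs_nonneg _) (Real.abs_sin_le_one _))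

/-- The double-angle formulas express second moments through `φ(2t)`; this identifies `Σ_z` as the
covariance. -/
theorem variance_cos_sin (ξ : Fin 2 → ℝ) :
    Var[fun x => ξ 0 * Real.cos (t * x) + ξ 1 * Real.sin (t * x); μ] =
      ξ ⬝ᵥ sigmaZ μ t *ᵥ ξ := by
  rw [variance_eq_sub (memLp_two_cos_sin μ t _ _)]
  have hc := integrable_cos_mul μ
  have hs := integrable_sin_mul μ
  have hexp : ∀ x, ((fun x => ξ 0 * Real.cos (t * x) + ξ 1 * Real.sin (t * x)) ^ 2) x =
      ((ξ 0 ^ 2 + ξ 1 ^ 2) / 2 + (ξ 0 ^ 2 - ξ 1 ^ 2) / 2 * Real.cos (2 * t * x)) +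
        ξ 0 * ξ 1 * Real.sin (2 * t * x) := by
    intro x
    rw [mul_assoc 2 t x, Real.cos_two_mul, Real.sin_two_mul]
    simp only [Pi.pow_apply]
    linear_combination ξ 1 ^ 2 * Real.sin_sq_add_cos_sq (t * x)
  simp only [hexp]
  rw [integral_add ((integrable_const _).fun_add ((hc _).const_mul _)) ((hs _).const_mul _),
    integral_add (integrable_const _) ((hc _).const_mul _),
    integral_add ((hc _).const_mul _) ((hs _).const_mul _)]
  simp only [integral_const_mul, integral_const, ← charFun_re_eq_integral_cos,
    ← charFun_im_eq_integral_sin, probReal_univ, one_smul, dotProduct, Matrix.mulVec,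
    Fin.sum_univ_two, sigmaZ_apply_zero_zero, sigmaZ_apply_one_one, sigmaZ_apply_one_zero,
    sigmaZ_apply_zero_one]
  ring

/-- A null direction would be a combination of zero variance, hence a.s. constant. -/
theorem posDef_sigmaZ (hlim : Tendsto (fun n : ℕ => charFun μ (n * t)) atTop (𝓝 0))
    (hone : ‖charFun μ t‖ ≠ 1) : (sigmaZ μ t).PosDef := by
  refine Matrix.PosDef.of_dotProduct_mulVec_pos ?_ fun ξ hξ => ?_
  · ext i j
    fin_cases i <;> fin_cases j <;> rfl
  · rw [star_trivial, ← variance_cos_sin]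
    refine (variance_nonneg _ _).lt_of_ne' fun hzero => ?_
    refine not_ae_eq_const_cos_sin (a := ξ 0) (b := ξ 1) hlim hone ?_
      (ae_eq_integral_of_variance_eq_zero (memLp_two_cos_sin μ t _ _) hzero)
    by_contra! h
    exact hξ (by ext i; fin_cases i <;> simp [h])

end Covariance

/-! ### Central limit theorem for the empirical characteristic function -/

/-- The point `(cos (t x), sin (t x))` of the Euclidean plane. -/
noncomputable def trigVec (t x : ℝ) : EuclideanSpace ℝ (Fin 2) :=
  WithLp.toLp 2 ![Real.cos (t * x), Real.sin (t * x)]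

theorem measurable_trigVec (t : ℝ) : Measurable (trigVec t) := by
  refine (PiLp.continuous_toLp 2 _).measurable.comp (measurable_pi_lambda _ fun i => ?_)
  fin_cases i
  · exact Real.measurable_cos.comp (measurable_const_mul t)
  · exact Real.measurable_sin.comp (measurable_const_mul t)

theorem memLp_two_trigVec (μ : Measure ℝ) [IsProbabilityMeasure μ] (t : ℝ) :
    MemLp (trigVec t) 2 μ := by
  refine MemLp.of_bound (C := 1) (measurable_trigVec t).aestronglyMeasurable
    (.of_forall fun x => ?_)
  simp [EuclideanSpace.norm_eq, trigVec]

theorem inner_trigVec (t x : ℝ) (ξ : EuclideanSpace ℝ (Fin 2)) :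
    ⟪ξ, trigVec t x⟫ = ξ 0 * Real.cos (t * x) + ξ 1 * Real.sin (t * x) := by
  simp [trigVec, PiLp.inner_apply, mul_comm]

theorem integral_trigVec (μ : Measure ℝ) [IsProbabilityMeasure μ] (t : ℝ) :
    ∫ x, trigVec t x ∂μ = WithLp.toLp 2 (cfVec μ t) := by
  refine ext_inner_left ℝ fun ξ => ?_
  rw [← integral_inner ((memLp_two_trigVec μ t).integrable one_le_two)]
  simp only [inner_trigVec]
  rw [integral_add ((integrable_cos_mul μ t).const_mul _) ((integrable_sin_mul μ t).const_mul _),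
    integral_const_mul, integral_const_mul, ← charFun_re_eq_integral_cos,
    ← charFun_im_eq_integral_sin]
  simp [cfVec, PiLp.inner_apply, mul_comm]

/-- The normalised deviation `√n (Z_n - Z_0)` as a vector of the Euclidean plane. -/
noncomputable def ecfDeviation (μ : Measure ℝ) (t : ℝ) (n : ℕ) (x : ℕ → ℝ) :
    EuclideanSpace ℝ (Fin 2) :=
  (√(n : ℝ))⁻¹ • (∑ k ∈ Finset.range n, trigVec t (x k) - (n : ℝ) • WithLp.toLp 2 (cfVec μ t))

theorem ofLp_ecfDeviation (μ : Measure ℝ) (t : ℝ) (n : ℕ) (x : ℕ → ℝ) :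
    (ecfDeviation μ t n x).ofLp = √(n : ℝ) • (ecfVec t x n - cfVec μ t) := by
  -- At `n = 0` both sides vanish, since `√0 = 0` and `0⁻¹ = 0`.
  rcases n.eq_zero_or_pos with rfl | hn
  · simp [ecfDeviation]
  have hsum : (∑ k ∈ Finset.range n, trigVec t (x k)).ofLp = (n : ℝ) • ecfVec t x n := by
    rw [ecfVec, smul_smul, mul_one_div_cancel (by positivity), one_smul, WithLp.ofLp_sum]
    rfl
  rw [ecfDeviation, WithLp.ofLp_smul, WithLp.ofLp_sub, hsum, WithLp.ofLp_smul, ← smul_sub,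
    smul_smul]
  congr 1
  rw [inv_mul_eq_div, Real.div_sqrt]

theorem mahalanobisStat_eq_of_smul {n : ℕ} {S : Matrix (Fin 2) (Fin 2) ℝ} {z w d : Fin 2 → ℝ}
    (hd : d = √(n : ℝ) • (z - w)) : mahalanobisStat n S z w = d ⬝ᵥ S⁻¹ *ᵥ d := by
  rw [hd, mahalanobisStat, Matrix.mulVec_smul, dotProduct_smul, smul_dotProduct, smul_eq_mul,
    smul_eq_mul, ← mul_assoc, Real.mul_self_sqrt (Nat.cast_nonneg n)]

theorem measurable_ecfDeviation (μ : Measure ℝ) (t : ℝ) (n : ℕ) :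
    Measurable (ecfDeviation μ t n) := by
  have hsum : Measurable fun x : ℕ → ℝ => ∑ k ∈ Finset.range n, trigVec t (x k) :=
    Finset.measurable_fun_sum _ fun k _ => (measurable_trigVec t).comp (measurable_pi_apply k)
  exact (hsum.sub_const _).const_smul (√(n : ℝ))⁻¹

theorem tendstoInDistribution_ecfDeviation {Ω : Type*} [MeasurableSpace Ω] {P : Measure Ω}
    [IsProbabilityMeasure P] {μ : Measure ℝ} [IsProbabilityMeasure μ] {t : ℝ}
    (hpos : (sigmaZ μ t).PosSemidef) {X : ℕ → Ω → ℝ}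
    (hlaw : ∀ k, HasLaw (X k) μ P) (hindep : iIndepFun X P) :
    TendstoInDistribution (fun n ω => ecfDeviation μ t n fun k => X k ω) atTop (fun x => x)
      (fun _ => P) (multivariateGaussian 0 (sigmaZ μ t)) := by
  have hident (k : ℕ) : IdentDistrib (X k) (X 0) P P :=
    ⟨(hlaw k).aemeasurable, (hlaw 0).aemeasurable, by rw [(hlaw k).map_eq, (hlaw 0).map_eq]⟩
  have hmean : ∫ ω, trigVec t (X 0 ω) ∂P = WithLp.toLp 2 (cfVec μ t) := by
    rw [← integral_trigVec]
    exact (hlaw 0).integral_comp (measurable_trigVec t).aestronglyMeasurable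
  have hclt := tendstoInDistribution_multivariateGaussian (Y := fun k ω => trigVec t (X k ω)) hpos
    ?_ (hindep.comp (fun _ => trigVec t) fun _ => measurable_trigVec t)
    (fun k => (hident k).comp (measurable_trigVec t)) ?_
  · simp only [hmean] at hclt
    exact hclt
  · have hmem := memLp_two_trigVec μ t
    rw [← (hlaw 0).map_eq] at hmem
    exact hmem.comp_of_map (hlaw 0).aemeasurable
  · intro ξ
    rw [← variance_cos_sin, ← (hlaw 0).map_eq, variance_map (by fun_prop) (hlaw 0).aemeasurable]
    simp only [inner_trigVec]
    rfl

/-! ### The two test statistics -/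

theorem theorem2
    {Ω : Type*} [MeasurableSpace Ω] (P : Measure Ω) [IsProbabilityMeasure P]
    (α σ β δ : ℝ) (μ : Measure ℝ) (hμ : IsStableLaw α σ β δ μ) (hσ : 0 < σ)
    (t : ℝ) (ht : t ≠ 0)
    -- two samples, each of them i.i.d. with law `μ`
    (X : Fin 2 → ℕ → Ω → ℝ)
    (hlaw : ∀ i k, HasLaw (X i k) μ P)
    (hiid : ∀ i, iIndepFun (X i) P)
    -- a consistent estimator of `Σ_z`
    (S : ℕ → Ω → Matrix (Fin 2) (Fin 2) ℝ)
    (hS : TendstoInDistribution S atTop (fun _ : Ω => sigmaZ μ t) (fun _ => P) P) :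
    -- (a) one sample against the true characteristic function
    (∀ i : Fin 2,
      TendstoInDistribution
        (fun (n : ℕ) (ω : Ω) =>
          mahalanobisStat n (S n ω) (ecfVec t (fun k => X i k ω) n) (cfVec μ t))
        atTop (fun y : ℝ => y) (fun _ => P) (chiSquared 2)) ∧
    -- (b) two independent samples: the limit is the law of `2 * Y` with `Y ∼ χ²(2)`,
    -- equivalently half of the statistic converges to `χ²(2)`
    (IndepFun (fun ω k => X 0 k ω) (fun ω k => X 1 k ω) P →
      TendstoInDistribution
        (fun (n : ℕ) (ω : Ω) =>
          mahalanobisStat n (S n ω) (ecfVec t (fun k => X 0 k ω) n)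
            (ecfVec t (fun k => X 1 k ω) n))
        atTop (fun y : ℝ => 2 * y) (fun _ => P) (chiSquared 2) ∧
      TendstoInDistribution
        (fun (n : ℕ) (ω : Ω) =>
          mahalanobisStat n (S n ω) (ecfVec t (fun k => X 0 k ω) n)
            (ecfVec t (fun k => X 1 k ω) n) / 2)
        atTop (fun y : ℝ => y) (fun _ => P) (chiSquared 2)) := by
  have := hμ.isProbabilityMeasure
  have hpos : (sigmaZ μ t).PosDef :=
    posDef_sigmaZ μ t (hμ.tendsto_charFun_natCast_mul hσ ht) (hμ.norm_charFun_ne_one hσ ht)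
  have hdev (i : Fin 2) := tendstoInDistribution_ecfDeviation hpos.posSemidef (hlaw i) (hiid i)
  refine ⟨fun i => ?_, fun hindep => ?_⟩
  · simp only [fun n ω => mahalanobisStat_eq_of_smul (S := S n ω)
      (ofLp_ecfDeviation μ t n fun k => X i k ω)]
    exact tendstoInDistribution_quadraticForm_chiSquared hpos (hdev i) hS
  have hdiff := tendstoInDistribution_quadraticForm_chiSquared hpos
    (tendstoInDistribution_sub_multivariateGaussian hpos.posSemidef (hdev 0) (hdev 1) fun n =>
      hindep.comp (measurable_ecfDeviation μ t n) (measurable_ecfDeviation μ t n)) hS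
  -- The true mean cancels in the difference, and the squared `1/√2` becomes the factor one half.
  have hstat (n : ℕ) (ω : Ω) : ((√2 : ℝ)⁻¹ • (ecfDeviation μ t n (fun k => X 0 k ω) -
        ecfDeviation μ t n fun k => X 1 k ω)).ofLp ⬝ᵥ (S n ω)⁻¹ *ᵥ
      ((√2 : ℝ)⁻¹ • (ecfDeviation μ t n (fun k => X 0 k ω) -
        ecfDeviation μ t n fun k => X 1 k ω)).ofLp =
      mahalanobisStat n (S n ω) (ecfVec t (fun k => X 0 k ω) n)
        (ecfVec t (fun k => X 1 k ω) n) / 2 := by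
    have hd : (ecfDeviation μ t n (fun k => X 0 k ω) -
          ecfDeviation μ t n fun k => X 1 k ω).ofLp =
        √(n : ℝ) • (ecfVec t (fun k => X 0 k ω) n - ecfVec t (fun k => X 1 k ω) n) := by
      rw [WithLp.ofLp_sub, ofLp_ecfDeviation, ofLp_ecfDeviation]
      module
    rw [mahalanobisStat_eq_of_smul hd, WithLp.ofLp_smul, Matrix.mulVec_smul, dotProduct_smul,
      smul_dotProduct, smul_eq_mul, smul_eq_mul, ← mul_assoc, ← mul_inv,
      Real.mul_self_sqrt zero_le_two, inv_mul_eq_div]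
  simp only [hstat] at hdiff
  refine ⟨?_, hdiff⟩
  have htwo := hdiff.continuous_comp (g := fun y => 2 * y) (by fun_prop)
  simpa only [Function.comp_def, mul_div_cancel₀ _ (two_ne_zero' ℝ)] using htwo
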